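/- Let $X$ be a complex Banach space and let $T$ be a bounded linear operator on $X$. For a bounded operator $S$ on $X$ let $R(S)$ denote its range, let $d(S)=\min\{q\in\mathbb{N} : R(S^q)=R(S^{q+1})\}$ be its descent and $d_e(S)=\min\{n\in\mathbb{N} : \dim (R(S^n)/R(S^{n+1}))<\infty\}$ its essential descent (each is $\infty$ if there is no such integer; $\mathbb{N}$ contains $0$). Put $$\sigma_{desc}(T)=\{\lambda\in\mathbb{C} : d(\lambda-T)=\infty\},\qquad \sigma^e_{desc}(T)=\{\lambda\in\mathbb{C} : d_e(\lambda-T)=\infty\}.$$ Suppose that $T$ satisfies at least one of the following two properties. 1. $T$ is decomposable: for all open sets $U,V\subseteq\mathbb{C}$ with $U\cup V=\mathbb{C}$ there are closed $T$-invariant linear subspaces $Y,Z$ of $X$ with $\sigma(T|_Y)\subseteq U$, $\sigma(T|_Z)\subseteq V$ and $X=Y+Z$. 2. $T$ has the decomposition property $(\delta)$: for all open sets $U,V\subseteq\mathbb{C}$ with $U\cup V=\mathbb{C}$ one has $X=\mathcal{X}_T(\overline U)+\mathcal{X}_T(\overline V)$, where, for closed $F\subseteq\mathbb{C}$, $\mathcal{X}_T(F)$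 is the space of all $x\in X$ for which there is an analytic function $f:\mathbb{C}\setminus F\to X$ with $(T-\mu)f(\mu)=x$ for all $\mu\in\mathbb{C}\setminus F$. Then $\sigma_{desc}(T)=\sigma^e_{desc}(T)$. -/

import Mathlib

namespace EssDescent

variable {X : Type*} [NormedAddCommGroup X] [NormedSpace ℂ X]

/-- The range `R(T ^ n)` of the `n`-th power of `T`. -/
def rangePow (T : X →L[ℂ] X) (n : ℕ) : Submodule ℂ X :=
  LinearMap.range ((T ^ n : X →L[ℂ] X) : X →ₗ[ℂ] X)

/-- The number `c_n(T) = dim (R(T ^ n) / R(T ^ (n + 1)))`, with value `⊤` when the dimension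
is infinite. -/
noncomputable def c (T : X →L[ℂ] X) (n : ℕ) : ℕ∞ :=
  Cardinal.toENat
    (Module.rank ℂ (rangePow T n ⧸ (rangePow T (n + 1)).submoduleOf (rangePow T n)))

/-- The descent: the least `q` with `R(T ^ q) = R(T ^ (q + 1))`, and `⊤` if there is none. -/
noncomputable def descent (T : X →L[ℂ] X) : ℕ∞ :=
  ⨅ (q : ℕ) (_ : rangePow T q = rangePow T (q + 1)), (q : ℕ∞)

/-- The essential descent: the least `n` with `c_n(T)` finite, and `⊤` if there is none. -/
noncomputable def essDescent (T : X →L[ℂ] X) : ℕ∞ :=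
  ⨅ (n : ℕ) (_ : c T n < ⊤), (n : ℕ∞)

/-- The descent spectrum of `T`. -/
def descentSpectrum (T : X →L[ℂ] X) : Set ℂ :=
  {z | descent (z • (1 : X →L[ℂ] X) - T) = ⊤}

/-- The essential descent spectrum of `T`. -/
def essDescentSpectrum (T : X →L[ℂ] X) : Set ℂ :=
  {z | essDescent (z • (1 : X →L[ℂ] X) - T) = ⊤}

/-- `T` is decomposable: every cover of `ℂ` by two open sets `U`, `V` admits closed
`T`-invariant subspaces `Y`, `Z` with `X = Y + Z`, `σ(T|Y) ⊆ U` and `σ(T|Z) ⊆ V`, the spectra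
being taken in the algebras of bounded operators on `Y` and on `Z`. -/
def IsDecomposable (T : X →L[ℂ] X) : Prop :=
  ∀ U V : Set ℂ, IsOpen U → IsOpen V → U ∪ V = Set.univ →
    ∃ (Y Z : Submodule ℂ X) (hY : ∀ y ∈ Y, T y ∈ Y) (hZ : ∀ z ∈ Z, T z ∈ Z),
      IsClosed (Y : Set X) ∧ IsClosed (Z : Set X) ∧
      spectrum ℂ (T.restrict hY) ⊆ U ∧ spectrum ℂ (T.restrict hZ) ⊆ V ∧
      Y ⊔ Z = ⊤

/-- The glocal spectral subspace of `T` for a closed set `F`: all `x` for which there is an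
analytic `f` on the complement of `F` with `(T - z) f(z) = x` there. -/
def glocalSubspace (T : X →L[ℂ] X) (F : Set ℂ) : Submodule ℂ X where
  carrier := {x | ∃ f : ℂ → X, AnalyticOnNhd ℂ f Fᶜ ∧
    ∀ z ∈ Fᶜ, (T - z • (1 : X →L[ℂ] X)) (f z) = x}
  zero_mem' := ⟨fun _ => 0, analyticOnNhd_const, fun z _ => map_zero _⟩
  add_mem' := by
    rintro x y ⟨f, hf, hfx⟩ ⟨g, hg, hgy⟩
    refine ⟨fun z => f z + g z, hf.add hg, fun z hz => ?_⟩
    rw [map_add, hfx z hz, hgy z hz]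
  smul_mem' := by
    rintro a x ⟨f, hf, hfx⟩
    refine ⟨fun z => a • f z, analyticOnNhd_const.smul hf, fun z hz => ?_⟩
    rw [map_smul, hfx z hz]

/-- The decomposition property (δ): `X` is the sum of the glocal spectral subspaces for the
closures of `U` and `V`, for every cover of `ℂ` by two open sets `U`, `V`. -/
def HasPropertyDelta (T : X →L[ℂ] X) : Prop :=
  ∀ U V : Set ℂ, IsOpen U → IsOpen V → U ∪ V = Set.univ →
    glocalSubspace T (closure U) ⊔ glocalSubspace T (closure V) = ⊤

end EssDescent

namespace EssDescent

/-! Write `S = a - T`. Finite descent trivially gives finite essential descent. For the converse, `S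
^ n` identifies the quotient of `R(S ^ n)` by `R(S ^ (n + 1))` with `X` modulo `R(S) + N(S ^ n)`. If
it is finite dimensional, these increasing subspaces stabilise at some `M`, and it remains to show
`M = X`.

If `M ≠ X`, the open mapping theorem yields functionals with `ψ 0 ≠ 0`, `ψ 0 ∘ S = 0`, `ψ (k + 1) ∘
S = ψ k` and geometric growth (`exists_functional_chain`), so `∑ μ ^ k ψ k` annihilates `R(S - μ)`
for small `μ`. Either property of `T` splits each `x` as `y + S z` with `y ∈ R(S - μ)` off a small
disc (`HasLocalSplitting`). The series at `y` vanishes on an annulus, hence at `0`, so `ψ 0 x = ψ 0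
y = 0`, a contradiction. -/

theorem mem_rangePow {X : Type*} [NormedAddCommGroup X] [NormedSpace ℂ X] {S : X →L[ℂ] X} {n : ℕ}
    {x : X} : x ∈ rangePow S n ↔ ∃ y, (S ^ n) y = x := by
  simp only [rangePow, LinearMap.mem_range]
  rfl

theorem rangePow_succ_le {X : Type*} [NormedAddCommGroup X] [NormedSpace ℂ X] (S : X →L[ℂ] X)
    (n : ℕ) : rangePow S (n + 1) ≤ rangePow S n := by
  intro x hx
  obtain ⟨y, rfl⟩ := mem_rangePow.1 hx
  exact mem_rangePow.2 ⟨S y, by rw [pow_succ]; rfl⟩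

theorem descent_eq_top_iff {X : Type*} [NormedAddCommGroup X] [NormedSpace ℂ X]
    {S : X →L[ℂ] X} : descent S = ⊤ ↔ ∀ q, rangePow S q ≠ rangePow S (q + 1) := by
  simp [descent, iInf_eq_top]

theorem essDescent_eq_top_iff {X : Type*} [NormedAddCommGroup X] [NormedSpace ℂ X]
    {S : X →L[ℂ] X} : essDescent S = ⊤ ↔ ∀ n, c S n = ⊤ := by
  simp [essDescent, iInf_eq_top]

theorem c_eq_zero_of_rangePow_eq {X : Type*} [NormedAddCommGroup X] [NormedSpace ℂ X]
    {S : X →L[ℂ] X} {q : ℕ} (h : rangePow S q = rangePow S (q + 1)) : c S q = 0 := by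
  have : (rangePow S (q + 1)).submoduleOf (rangePow S q) = ⊤ :=
    Submodule.submoduleOf_eq_top.2 h.le
  have hs : Subsingleton
      (rangePow S q ⧸ (rangePow S (q + 1)).submoduleOf (rangePow S q)) :=
    Submodule.Quotient.subsingleton_iff.2 this
  rw [c, rank_subsingleton', map_zero]

/-! ### The subspaces `R(S) + N(S ^ n)` -/

/-- The subspace `R(S) + N(S ^ n)`, whose codimension is `c S n`. -/
def rangeSupKer {X : Type*} [NormedAddCommGroup X] [NormedSpace ℂ X] (S : X →L[ℂ] X) (n : ℕ) :
    Submodule ℂ X :=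
  LinearMap.range (S : X →ₗ[ℂ] X) ⊔ LinearMap.ker ((S ^ n : X →L[ℂ] X) : X →ₗ[ℂ] X)

theorem mem_rangeSupKer {X : Type*} [NormedAddCommGroup X] [NormedSpace ℂ X] {S : X →L[ℂ] X}
    {n : ℕ} {x : X} : x ∈ rangeSupKer S n ↔ ∃ y k, (S ^ n) k = 0 ∧ S y + k = x := by
  rw [rangeSupKer, Submodule.mem_sup]
  constructor
  · rintro ⟨_, ⟨y, rfl⟩, k, hk, rfl⟩
    exact ⟨y, k, hk, rfl⟩
  · rintro ⟨y, k, hk, rfl⟩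
    exact ⟨S y, ⟨y, rfl⟩, k, hk, rfl⟩

theorem pow_apply_eq_zero_of_le {X : Type*} [NormedAddCommGroup X] [NormedSpace ℂ X]
    {S : X →L[ℂ] X} {m n : ℕ} (h : m ≤ n) {x : X} (hx : (S ^ m) x = 0) : (S ^ n) x = 0 := by
  obtain ⟨k, rfl⟩ := Nat.exists_eq_add_of_le' h
  rw [pow_add, mul_apply_eq_comp, hx, map_zero]

theorem rangeSupKer_mono {X : Type*} [NormedAddCommGroup X] [NormedSpace ℂ X] (S : X →L[ℂ] X) :
    Monotone (rangeSupKer S) := by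
  intro m n hmn x hx
  obtain ⟨y, k, hk, rfl⟩ := mem_rangeSupKer.1 hx
  exact mem_rangeSupKer.2 ⟨y, k, pow_apply_eq_zero_of_le hmn hk, rfl⟩

theorem rangePow_eq_of_rangeSupKer_eq_top {X : Type*} [NormedAddCommGroup X] [NormedSpace ℂ X]
    {S : X →L[ℂ] X} {n : ℕ} (h : rangeSupKer S n = ⊤) :
    rangePow S n = rangePow S (n + 1) := by
  refine le_antisymm (fun x hx => ?_) (rangePow_succ_le S n)
  obtain ⟨y, rfl⟩ := mem_rangePow.1 hx
  obtain ⟨w, k, hk, rfl⟩ := mem_rangeSupKer.1 (h ▸ Submodule.mem_top : y ∈ rangeSupKer S n)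
  exact mem_rangePow.2 ⟨w, by rw [map_add, hk, add_zero, pow_succ]; rfl⟩

theorem finite_quotient_rangeSupKer {X : Type*} [NormedAddCommGroup X] [NormedSpace ℂ X]
    {S : X →L[ℂ] X} {n : ℕ} (h : c S n < ⊤) : Module.Finite ℂ (X ⧸ rangeSupKer S n) := by
  have hfin : Module.Finite ℂ
      (rangePow S n ⧸ (rangePow S (n + 1)).submoduleOf (rangePow S n)) :=
    Module.rank_lt_aleph0_iff.1 (by rwa [c, Cardinal.toENat_lt_top] at h)
  let g : X →ₗ[ℂ] rangePow S n ⧸ (rangePow S (n + 1)).submoduleOf (rangePow S n) :=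
    (Submodule.mkQ _).comp (LinearMap.rangeRestrict ((S ^ n : X →L[ℂ] X) : X →ₗ[ℂ] X))
  have hker : LinearMap.ker g ≤ rangeSupKer S n := by
    intro x hx
    have hx' : (S ^ n) x ∈ rangePow S (n + 1) := by
      have := (Submodule.Quotient.mk_eq_zero _).1 (LinearMap.mem_ker.1 hx)
      exact this
    obtain ⟨y, hy⟩ := mem_rangePow.1 hx'
    refine mem_rangeSupKer.2 ⟨y, x - S y, ?_, by abel⟩
    rw [map_sub, ← hy, pow_succ, mul_apply_eq_comp, sub_self]
  have : Module.Finite ℂ (X ⧸ LinearMap.ker g) :=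
    Module.Finite.of_injective _ (LinearMap.ker_eq_bot.1 (Submodule.ker_liftQ_eq_bot _ g le_rfl le_rfl))
  exact Module.Finite.of_surjective _ (Submodule.factor_surjective hker)

theorem exists_rangeSupKer_eq {X : Type*} [NormedAddCommGroup X] [NormedSpace ℂ X]
    {S : X →L[ℂ] X} {n : ℕ} (h : Module.Finite ℂ (X ⧸ rangeSupKer S n)) :
    ∃ d, n ≤ d ∧ ∀ m, d ≤ m → rangeSupKer S d = rangeSupKer S m := by
  let f : ℕ →o Submodule ℂ (X ⧸ rangeSupKer S n) :=
    ⟨fun m => (rangeSupKer S (n + m)).map (rangeSupKer S n).mkQ,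
      fun a b hab => Submodule.map_mono (rangeSupKer_mono S (by omega))⟩
  obtain ⟨N, hN⟩ := monotone_stabilizes_iff_noetherian.2 inferInstance f
  refine ⟨n + N, by omega, fun m hm => ?_⟩
  obtain ⟨j, rfl⟩ := Nat.exists_eq_add_of_le hm
  have : Submodule.comap (rangeSupKer S n).mkQ
      ((rangeSupKer S (n + N)).map (rangeSupKer S n).mkQ) =
      Submodule.comap (rangeSupKer S n).mkQ
      ((rangeSupKer S (n + (N + j))).map (rangeSupKer S n).mkQ) :=
    congrArg _ (hN (N + j) (by omega))
  rw [Submodule.comap_map_mkQ, Submodule.comap_map_mkQ, sup_eq_right.2 (rangeSupKer_mono S (by omega)),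
    sup_eq_right.2 (rangeSupKer_mono S (by omega)), ← add_assoc] at this
  exact this

/-! ### Chains of functionals from the open mapping theorem -/

/-- A continuous functional vanishing on the kernel of a surjection of Banach spaces descends, with
control of the norm. -/
theorem exists_descend_functional {E X : Type*} [NormedAddCommGroup E] [NormedSpace ℂ E]
    [CompleteSpace E] [NormedAddCommGroup X] [NormedSpace ℂ X] [CompleteSpace X] (B : E →L[ℂ] X)
    (hB : Function.Surjective B) : ∃ C : ℝ, 0 ≤ C ∧ ∀ θ : E →L[ℂ] ℂ, (∀ e, B e = 0 → θ e = 0) →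
      ∃ ψ : X →L[ℂ] ℂ, (∀ e, ψ (B e) = θ e) ∧ ‖ψ‖ ≤ C * ‖θ‖ := by
  obtain ⟨C, hC, h⟩ := B.exists_preimage_norm_le hB
  refine ⟨C, hC.le, fun θ hθ => ?_⟩
  choose s hs hsC using h
  have key : ∀ e, θ (s (B e)) = θ e := fun e => by
    rw [← sub_eq_zero, ← map_sub]
    exact hθ _ (by rw [map_sub, hs, sub_self])
  let ψ : X →ₗ[ℂ] ℂ :=
    { toFun := fun x => θ (s x)
      map_add' := fun x y => by
        rw [← map_add, ← key (s x + s y), map_add B, hs, hs]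
      map_smul' := fun a x => by
        rw [RingHom.id_apply, ← map_smul, ← key (a • s x), map_smul B, hs] }
  have hψ : ∀ x, ‖ψ x‖ ≤ C * ‖θ‖ * ‖x‖ := fun x => calc
    ‖θ (s x)‖ ≤ ‖θ‖ * ‖s x‖ := θ.le_opNorm _
    _ ≤ ‖θ‖ * (C * ‖x‖) := by gcongr; exact hsC x
    _ = C * ‖θ‖ * ‖x‖ := by ring
  exact ⟨ψ.mkContinuous _ hψ, key, ψ.mkContinuous_norm_le (by positivity) hψ⟩

/-- With `F` a finite-dimensional complement of the stable subspace, `X × N(S ^ d) × F` maps onto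
`X`. Functionals on this product that kill the kernel descend to `X` with one constant `C`, so each
link of the chain costs a factor `C`. -/
theorem exists_functional_chain {X : Type*} [NormedAddCommGroup X] [NormedSpace ℂ X]
    [CompleteSpace X] {S : X →L[ℂ] X} {d : ℕ} (hfin : Module.Finite ℂ (X ⧸ rangeSupKer S d))
    (hd : ∀ m, d ≤ m → rangeSupKer S d = rangeSupKer S m) (htop : rangeSupKer S d ≠ ⊤) :
    ∃ (ψ : ℕ → X →L[ℂ] ℂ) (C : ℝ), 0 ≤ C ∧ ψ 0 ≠ 0 ∧ (∀ x, ψ 0 (S x) = 0) ∧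
      (∀ k x, ψ (k + 1) (S x) = ψ k x) ∧ ∀ k, ‖ψ k‖ ≤ ‖ψ 0‖ * C ^ k := by
  obtain ⟨F, hF⟩ := Submodule.exists_isCompl (rangeSupKer S d)
  have : FiniteDimensional ℂ F :=
    Module.Finite.equiv (Submodule.quotientEquivOfIsCompl _ _ hF)
  let K : Submodule ℂ X := LinearMap.ker ((S ^ d : X →L[ℂ] X) : X →ₗ[ℂ] X)
  have hK : IsClosed (K : Set X) := (S ^ d).isClosed_ker
  have : CompleteSpace K := hK.completeSpace_coe
  have : CompleteSpace F := FiniteDimensional.complete ℂ F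
  let B : (X × K × F) →L[ℂ] X := S.coprod (K.subtypeL.coprod F.subtypeL)
  have hBa : ∀ e : X × K × F, B e = S e.1 + ((e.2.1 : X) + (e.2.2 : X)) := fun e => rfl
  have hB : Function.Surjective B := by
    intro x
    obtain ⟨y, hy, f, hf, rfl⟩ := Submodule.mem_sup.1
      (hF.sup_eq_top ▸ Submodule.mem_top : x ∈ rangeSupKer S d ⊔ F)
    obtain ⟨w, k, hk, rfl⟩ := mem_rangeSupKer.1 hy
    exact ⟨(w, ⟨k, hk⟩, ⟨f, hf⟩), by rw [hBa, add_assoc]⟩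
  have hB0 : ∀ e : X × K × F, B e = 0 → e.2.2 = 0 ∧ (S ^ (d + 1)) e.1 = 0 := by
    rintro ⟨x, k, f⟩ h
    rw [hBa, ← add_assoc] at h
    have hM : S x + (k : X) ∈ rangeSupKer S d := mem_rangeSupKer.2 ⟨x, k, k.2, rfl⟩
    have hf : (f : X) = 0 := by
      refine Submodule.disjoint_def.1 hF.disjoint _ ?_ f.2
      rw [eq_neg_of_add_eq_zero_right h]
      exact neg_mem hM
    refine ⟨Subtype.ext hf, ?_⟩
    have hSx : S x = -(k : X) := by
      simpa [hf] using eq_neg_of_add_eq_zero_left (by simpa [hf] using h : S x + (k : X) = 0)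
    have hk : (S ^ d) (k : X) = 0 := k.2
    rw [pow_succ, mul_apply_eq_comp, hSx, map_neg, hk, neg_zero]
  obtain ⟨C, hC, hdesc⟩ := exists_descend_functional B hB
  -- The invariant of the recursion: vanishing on every `N(S ^ m)` is what lets `ψ` be divided by
  -- `S`, and the quotient inherits it.
  let P : Type _ := {ψ : X →L[ℂ] ℂ // ∀ m x, (S ^ m) x = 0 → ψ x = 0}
  have base : ∃ ψ : P, ψ.1 ≠ 0 ∧ ∀ x, ψ.1 (S x) = 0 := by
    have hF0 : F ≠ ⊥ := fun h => htop (by simpa [h] using hF.sup_eq_top)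
    obtain ⟨f, hf, hf0⟩ := Submodule.exists_mem_ne_zero_of_ne_bot hF0
    obtain ⟨g, hg⟩ := SeparatingDual.exists_ne_zero (R := ℂ) (x := (⟨f, hf⟩ : F))
      (fun h => hf0 (congrArg Subtype.val h))
    obtain ⟨ψ, hψ, -⟩ := hdesc
      (g.comp ((ContinuousLinearMap.snd ℂ K F).comp (ContinuousLinearMap.snd ℂ X (K × F))))
      (fun e he => by simp [(hB0 e he).1])
    have hψM : ∀ x ∈ rangeSupKer S d, ψ x = 0 := by
      intro x hx
      obtain ⟨w, k, hk, rfl⟩ := mem_rangeSupKer.1 hx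
      simpa [hBa] using hψ (w, ⟨k, hk⟩, 0)
    refine ⟨⟨ψ, fun m x hx => hψM x ?_⟩, fun h => hg ?_, fun x => hψM _ ?_⟩
    · rw [hd (max d m) (le_max_left _ _)]
      exact mem_rangeSupKer.2
        ⟨0, x, pow_apply_eq_zero_of_le (le_max_right _ _) hx, by simp⟩
    · have := hψ (0, 0, ⟨f, hf⟩)
      rw [show ψ = 0 from h] at this
      simpa using this.symm
    · exact mem_rangeSupKer.2 ⟨x, 0, map_zero _, by simp⟩
  have step : ∀ ψ : P, ∃ ψ' : P, (∀ x, ψ'.1 (S x) = ψ.1 x) ∧ ‖ψ'.1‖ ≤ C * ‖ψ.1‖ := by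
    rintro ⟨ψ, hψ⟩
    obtain ⟨ψ', hψ', hn⟩ := hdesc (ψ.comp (ContinuousLinearMap.fst ℂ X (K × F)))
      (fun e he => hψ (d + 1) _ (hB0 e he).2)
    have hS : ∀ x, ψ' (S x) = ψ x := fun x => by simpa [hBa] using hψ' (x, 0, 0)
    refine ⟨⟨ψ', fun m x hx => ?_⟩, hS, hn.trans ?_⟩
    · have hx' : x ∈ rangeSupKer S d := by
        rw [hd (max d m) (le_max_left _ _)]
        exact mem_rangeSupKer.2
          ⟨0, x, pow_apply_eq_zero_of_le (le_max_right _ _) hx, by simp⟩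
      obtain ⟨w, k, hk, rfl⟩ := mem_rangeSupKer.1 hx'
      have h1 : ψ' (S w + k) = ψ w := by simpa [hBa] using hψ' (w, ⟨k, hk⟩, 0)
      rw [h1]
      -- Both `x = S w + k` and `k` are killed by `S ^ max d m`, hence so is `S w`.
      refine hψ (max d m + 1) w ?_
      have h2 := pow_apply_eq_zero_of_le (le_max_right d m) hx
      rw [map_add, pow_apply_eq_zero_of_le (le_max_left d m) hk, add_zero] at h2
      rw [pow_succ, mul_apply_eq_comp, h2]
    · gcongr
      refine (ContinuousLinearMap.opNorm_comp_le _ _).trans ?_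
      exact mul_le_of_le_one_right (norm_nonneg _) (ContinuousLinearMap.norm_fst_le ..)
  obtain ⟨ψ₀, hne, h0⟩ := base
  choose next hnext hnorm using step
  refine ⟨fun k => (next^[k] ψ₀).1, C, hC, hne, h0, fun k x => ?_, fun k => ?_⟩
  · simp only [Function.iterate_succ_apply']
    exact hnext _ x
  · induction k with
    | zero => simp
    | succ k ih =>
      simp only [Function.iterate_succ_apply']
      calc _ ≤ C * ‖(next^[k] ψ₀).1‖ := hnorm _
        _ ≤ C * (_ * C ^ k) := by gcongr
        _ = _ := by ring

/-! ### Local splitting kills the chain -/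

/-- A power series with geometrically bounded coefficients whose sum vanishes near `0` off a
smaller disc has vanishing constant term. -/
theorem coeff_zero_eq_zero_of_tsum_eq_zero {a : ℕ → ℂ} {A C : ℝ} (hC : 0 ≤ C)
    (ha : ∀ k, ‖a k‖ ≤ A * C ^ k) {ε r : ℝ} (hεr : ε < r) (hr : 0 < r) (hrC : r * C < 1)
    (h : ∀ μ : ℂ, ε < ‖μ‖ → ‖μ‖ < r → ∑' k, a k * μ ^ k = 0) : a 0 = 0 := by
  have hd : DifferentiableOn ℂ (fun μ : ℂ => ∑' k, a k * μ ^ k) (Metric.ball 0 r) := by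
    refine Complex.differentiableOn_tsum_of_summable_norm (u := fun k => A * (r * C) ^ k)
      ((summable_geometric_of_lt_one (by positivity) hrC).mul_left A)
      (fun k => by fun_prop) Metric.isOpen_ball (fun k w hw => ?_)
    have hw' : ‖w‖ ≤ r := (mem_ball_zero_iff.1 hw).le
    have hA : 0 ≤ A * C ^ k := (norm_nonneg _).trans (ha k)
    rw [norm_mul, norm_pow]
    calc ‖a k‖ * ‖w‖ ^ k ≤ (A * C ^ k) * r ^ k := by gcongr; exact ha k
      _ = A * (r * C) ^ k := by rw [mul_pow]; ring
  have han := hd.analyticOnNhd Metric.isOpen_ball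
  obtain ⟨t, ht1, ht2⟩ := exists_between (max_lt hεr hr)
  have ht0 : 0 < t := (le_max_right _ _).trans_lt ht1
  have htε : ε < t := (le_max_left _ _).trans_lt ht1
  have hnt : ‖(t : ℂ)‖ = t := by simp [abs_of_pos ht0]
  have hev : ∀ᶠ μ : ℂ in nhds (t : ℂ), ∑' k, a k * μ ^ k = 0 := by
    filter_upwards [continuous_norm.continuousAt.eventually (lt_mem_nhds (hnt.symm ▸ htε)),
      continuous_norm.continuousAt.eventually (gt_mem_nhds (hnt.symm ▸ ht2))] with μ h1 h2
    exact h μ h1 h2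
  have := han.eqOn_zero_of_preconnected_of_eventuallyEq_zero
    (convex_ball (0 : ℂ) r).isPreconnected (mem_ball_zero_iff.2 (hnt.symm ▸ ht2)) hev
    (Metric.mem_ball_self hr)
  simp only [Pi.zero_apply] at this
  rw [tsum_eq_single 0 (fun k hk => by simp [hk])] at this
  simpa using this

/-- Arbitrarily close to `0`, the space is the sum of `R(S)` and of the vectors in the range of
`S - μ` for all `μ` outside a small disc. -/
def HasLocalSplitting {X : Type*} [NormedAddCommGroup X] [NormedSpace ℂ X] (S : X →L[ℂ] X) :
    Prop :=
  ∀ ε : ℝ, 0 < ε → ∀ x : X, ∃ y z, x = y + S z ∧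
    ∀ μ : ℂ, ε < ‖μ‖ → ∃ w, y = S w - μ • w

theorem HasLocalSplitting.chain_zero_eq_zero {X : Type*} [NormedAddCommGroup X]
    [NormedSpace ℂ X] {S : X →L[ℂ] X} (hS : HasLocalSplitting S) {ψ : ℕ → X →L[ℂ] ℂ} {C : ℝ}
    (hC : 0 ≤ C) (h0 : ∀ x, ψ 0 (S x) = 0) (hsucc : ∀ k x, ψ (k + 1) (S x) = ψ k x)
    (hψ : ∀ k, ‖ψ k‖ ≤ ‖ψ 0‖ * C ^ k) : ψ 0 = 0 := by
  obtain ⟨r, hr, hrC⟩ : ∃ r : ℝ, 0 < r ∧ r * C < 1 :=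
    ⟨1 / (C + 1), by positivity, by rw [div_mul_eq_mul_div, div_lt_one (by positivity)]; linarith⟩
  have hbound : ∀ x k, ‖ψ k x‖ ≤ ‖ψ 0‖ * ‖x‖ * C ^ k := fun x k => calc
    ‖ψ k x‖ ≤ ‖ψ k‖ * ‖x‖ := (ψ k).le_opNorm x
    _ ≤ (‖ψ 0‖ * C ^ k) * ‖x‖ := by gcongr; exact hψ k
    _ = ‖ψ 0‖ * ‖x‖ * C ^ k := by ring
  ext x
  -- The disc of radius `r / 2` leaves an annulus inside the region of convergence.
  obtain ⟨y, z, rfl, hy⟩ := hS (r / 2) (by positivity) x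
  rw [map_add, h0, add_zero, zero_apply]
  refine coeff_zero_eq_zero_of_tsum_eq_zero (a := fun k => ψ k y) hC (hbound y)
    (half_lt_self hr) hr hrC fun μ hμ hμr => ?_
  obtain ⟨w, rfl⟩ := hy μ hμ
  have hsum : ∀ v, Summable fun k => ψ k v * μ ^ k := fun v => by
    refine Summable.of_norm_bounded (g := fun k => ‖ψ 0‖ * ‖v‖ * (r * C) ^ k)
      ((summable_geometric_of_lt_one (by positivity) hrC).mul_left _) fun k => ?_
    rw [norm_mul, norm_pow]
    calc ‖ψ k v‖ * ‖μ‖ ^ k ≤ (‖ψ 0‖ * ‖v‖ * C ^ k) * r ^ k := by gcongr; exact hbound v k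
      _ = ‖ψ 0‖ * ‖v‖ * (r * C) ^ k := by rw [mul_pow]; ring
  have h1 : ∑' k, ψ k (S w) * μ ^ k = μ * ∑' k, ψ k w * μ ^ k := by
    rw [(hsum (S w)).tsum_eq_zero_add, ← tsum_mul_left]
    simp only [h0, zero_mul, zero_add, hsucc]
    exact tsum_congr fun k => by ring
  have h2 : ∀ k, ψ k (S w - μ • w) * μ ^ k = ψ k (S w) * μ ^ k - μ * (ψ k w * μ ^ k) :=
    fun k => by rw [map_sub, map_smul, smul_eq_mul]; ring
  rw [tsum_congr h2, (hsum (S w)).tsum_sub ((hsum w).mul_left μ), h1, tsum_mul_left, sub_self]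

theorem HasLocalSplitting.descent_ne_top {X : Type*} [NormedAddCommGroup X] [NormedSpace ℂ X]
    [CompleteSpace X] {S : X →L[ℂ] X} (hS : HasLocalSplitting S) (h : essDescent S ≠ ⊤) :
    descent S ≠ ⊤ := by
  rw [Ne, essDescent_eq_top_iff, not_forall] at h
  obtain ⟨n, hn⟩ := h
  have hfin := finite_quotient_rangeSupKer (lt_top_iff_ne_top.2 hn)
  obtain ⟨d, hnd, hd⟩ := exists_rangeSupKer_eq hfin
  have hfin' : Module.Finite ℂ (X ⧸ rangeSupKer S d) :=
    Module.Finite.of_surjective _ (Submodule.factor_surjective (rangeSupKer_mono S hnd))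
  intro htop
  obtain ⟨ψ, C, hC, hne, h0, hsucc, hψ⟩ := exists_functional_chain hfin' hd fun h =>
    descent_eq_top_iff.1 htop d (rangePow_eq_of_rangeSupKer_eq_top h)
  exact hne (hS.chain_zero_eq_zero hC h0 hsucc hψ)

theorem essDescent_ne_top_of_descent_ne_top {X : Type*} [NormedAddCommGroup X]
    [NormedSpace ℂ X] {S : X →L[ℂ] X} (h : descent S ≠ ⊤) : essDescent S ≠ ⊤ := by
  rw [Ne, descent_eq_top_iff, not_forall] at h
  obtain ⟨q, hq⟩ := h
  intro h
  have := essDescent_eq_top_iff.1 h q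
  rw [c_eq_zero_of_rangePow_eq (not_not.1 hq)] at this
  exact ENat.zero_ne_top this

/-! ### Both properties give the local splitting -/

theorem ball_union_compl_closedBall (a : ℂ) {ε : ℝ} (hε : 0 < ε) :
    Metric.ball a ε ∪ (Metric.closedBall a (ε / 2))ᶜ = Set.univ := by
  rw [← Set.compl_subset_iff_union, Set.compl_subset_compl]
  exact Metric.closedBall_subset_ball (half_lt_self hε)

theorem exists_preimage_of_notMem_spectrum_restrict {X : Type*} [NormedAddCommGroup X]
    [NormedSpace ℂ X] {T : X →L[ℂ] X} {Y : Submodule ℂ X} (hY : ∀ y ∈ Y, T y ∈ Y) {a : ℂ}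
    (ha : a ∉ spectrum ℂ (T.restrict hY)) {y : X} (hy : y ∈ Y) : ∃ w, a • w - T w = y := by
  obtain ⟨u, hu⟩ := spectrum.notMem_iff.1 ha
  have h : (u : Y →L[ℂ] Y) ((↑u⁻¹ : Y →L[ℂ] Y) ⟨y, hy⟩) = ⟨y, hy⟩ := by
    rw [← mul_apply_eq_comp, Units.mul_inv, one_apply_eq_self]
  rw [hu, Algebra.algebraMap_eq_smul_one] at h
  exact ⟨_, congrArg Subtype.val h⟩

theorem IsDecomposable.hasLocalSplitting {X : Type*} [NormedAddCommGroup X] [NormedSpace ℂ X]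
    {T : X →L[ℂ] X} (hT : IsDecomposable T) (a : ℂ) :
    HasLocalSplitting (a • (1 : X →L[ℂ] X) - T) := by
  intro ε hε x
  obtain ⟨Y, Z, hY, hZ, -, -, hYU, hZV, hYZ⟩ := hT _ _ Metric.isOpen_ball
    Metric.isClosed_closedBall.isOpen_compl (ball_union_compl_closedBall a hε)
  obtain ⟨y, hy, z, hz, rfl⟩ := Submodule.mem_sup.1 (hYZ ▸ Submodule.mem_top : x ∈ Y ⊔ Z)
  obtain ⟨w, hw⟩ := exists_preimage_of_notMem_spectrum_restrict hZ
    (fun h => hZV h (Metric.mem_closedBall_self (by positivity))) hz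
  refine ⟨y, w, by rw [← hw]; rfl, fun μ hμ => ?_⟩
  obtain ⟨v, hv⟩ := exists_preimage_of_notMem_spectrum_restrict hY (a := a - μ) (fun h => by
    have := hYU h
    rw [Metric.mem_ball, dist_eq_norm, sub_sub_cancel_left, norm_neg] at this
    exact this.not_gt hμ) hy
  refine ⟨v, ?_⟩
  change y = a • v - T v - μ • v
  rw [← hv, sub_smul]
  abel

theorem exists_preimage_of_mem_glocalSubspace {X : Type*} [NormedAddCommGroup X]
    [NormedSpace ℂ X] {T : X →L[ℂ] X} {F : Set ℂ} {x : X} (hx : x ∈ glocalSubspace T F) {a : ℂ}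
    (ha : a ∉ F) : ∃ w, a • w - T w = x := by
  obtain ⟨f, -, hf⟩ := hx
  refine ⟨-f a, ?_⟩
  rw [← hf a ha]
  change a • -f a - T (-f a) = T (f a) - a • f a
  rw [map_neg, smul_neg]
  abel

theorem HasPropertyDelta.hasLocalSplitting {X : Type*} [NormedAddCommGroup X] [NormedSpace ℂ X]
    {T : X →L[ℂ] X} (hT : HasPropertyDelta T) (a : ℂ) :
    HasLocalSplitting (a • (1 : X →L[ℂ] X) - T) := by
  intro ε hε x
  have hYZ := hT _ _ Metric.isOpen_ball
    Metric.isClosed_closedBall.isOpen_compl (ball_union_compl_closedBall a hε)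
  obtain ⟨y, hy, z, hz, rfl⟩ := Submodule.mem_sup.1 (hYZ ▸ Submodule.mem_top : x ∈ _ ⊔ _)
  -- Removing a whole disc around `a` keeps `a` out of the closure of the second open set.
  obtain ⟨w, hw⟩ := exists_preimage_of_mem_glocalSubspace (a := a) hz (by
    rw [closure_compl, Set.notMem_compl_iff]
    exact Metric.ball_subset_interior_closedBall (Metric.mem_ball_self (by positivity)))
  refine ⟨y, w, by rw [← hw]; rfl, fun μ hμ => ?_⟩
  obtain ⟨v, hv⟩ := exists_preimage_of_mem_glocalSubspace (a := a - μ) hy (fun h => by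
    have := Metric.closure_ball_subset_closedBall h
    rw [Metric.mem_closedBall, dist_eq_norm, sub_sub_cancel_left, norm_neg] at this
    exact this.not_gt hμ)
  refine ⟨v, ?_⟩
  change y = a • v - T v - μ • v
  rw [← hv, sub_smul]
  abel

end EssDescent

theorem mainTheorem3 {X : Type*} [NormedAddCommGroup X] [NormedSpace ℂ X] [CompleteSpace X]
    (T : X →L[ℂ] X) (hT : EssDescent.IsDecomposable T ∨ EssDescent.HasPropertyDelta T) :
    EssDescent.descentSpectrum T = EssDescent.essDescentSpectrum T := by
  have hS : ∀ a : ℂ, EssDescent.HasLocalSplitting (a • (1 : X →L[ℂ] X) - T) := fun a =>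
    hT.elim (fun h => h.hasLocalSplitting a) fun h => h.hasLocalSplitting a
  ext a
  exact ⟨fun h => by_contra fun h' => (hS a).descent_ne_top h' h,
    fun h => by_contra fun h' => EssDescent.essDescent_ne_top_of_descent_ne_top h' h⟩
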